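/- Let $V$ be a finite-dimensional Euclidean space and let $W$ be a finite Coxeter group acting on $V$ as a reflection group, that is, a finite group of linear isometries of $V$ generated by orthogonal reflections. Let $\mathcal A=\mathcal A(W)$ be its Coxeter arrangement, the set of all reflecting hyperplanes of $W$. Let $\mathcal B$ be a finite set of (affine) hyperplanes of $V$ that is stable under $W$ and satisfies $\mathcal A\cap\mathcal B=\emptyset$, and put $\mathcal C=\mathcal A\cup\mathcal B$. For an arrangement $\mathcal D$ let $\mathbf{Ch}(\mathcal D)$ be the set of its chambers, i.e. of connected components of $V\setminus\bigcup_{H\in\mathcal D}H$; for $\mathcal D=\mathcal A,\mathcal B,\mathcal C$ the group $W$ acts on this set, which is finite. (1) For every $a\in\mathbf{Ch}(\mathcal A)$, $$|\{c\in\mathbf{Ch}(\mathcal C): c\subseteq a\}|=\frac{|\mathbf{Ch}(\mathcal C)|}{|\mathbf{Ch}(\mathcal A)|}=\frac{|\mathbf{Ch}(\mathcal C)|}{|W|}=|\{W\text{-orbits of }\mathbf{Ch}(\mathcal C)\}|=|\{W\text{-orbits of }\mathbf{Ch}(\mathcal B)\}|.$$ (2) For every $b\in\mathbf{Ch}(\mathcal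 B)$, $$|\{c\in\mathbf{Ch}(\mathcal C): c\subseteq b\}|=|W_b|,\qquad W_b=\{w\in W: wb=b\}.$$ -/

import Mathlib

namespace CoxeterStable

variable {V : Type*} [NormedAddCommGroup V] [InnerProductSpace ℝ V]

/-- An (affine) hyperplane of a Euclidean space, as a set of points. -/
def IsHyperplane (H : Set V) : Prop :=
  ∃ v : V, v ≠ 0 ∧ ∃ t : ℝ, H = {x : V | inner ℝ v x = t}

/-- A hyperplane arrangement: a finite set of affine hyperplanes. -/
def IsArrangement (𝒟 : Set (Set V)) : Prop :=
  𝒟.Finite ∧ ∀ H ∈ 𝒟, IsHyperplane H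

/-- The chambers of `𝒟`: the connected components of the complement of the union of `𝒟`. -/
def chambers (𝒟 : Set (Set V)) : Set (Set V) :=
  {c | ∃ x ∈ (⋃₀ 𝒟)ᶜ, c = connectedComponentIn (⋃₀ 𝒟)ᶜ x}

/-- The chambers of `𝒟` which are contained in the set `s`. If `s` is a chamber of a
subarrangement of `𝒟`, this is the fibre over `s` of the map sending a chamber of `𝒟` to the
chamber of the subarrangement that contains it. -/
def chambersIn (𝒟 : Set (Set V)) (s : Set V) : Set (Set V) :=
  {c | c ∈ chambers 𝒟 ∧ c ⊆ s}

/-- `W` is a Coxeter group acting on `V` as a finite (real, orthogonal) reflection group: it is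
finite and generated by the orthogonal reflections in linear hyperplanes that it contains. -/
def IsFiniteReflectionGroup (W : Subgroup (V ≃ₗᵢ[ℝ] V)) : Prop :=
  Finite W ∧
    Subgroup.closure {s : V ≃ₗᵢ[ℝ] V | s ∈ W ∧ ∃ v : V, v ≠ 0 ∧ s = (ℝ ∙ v)ᗮ.reflection} = W

/-- The Coxeter arrangement of `W`: the set of all reflecting hyperplanes of `W`. -/
def coxeterArrangement (W : Subgroup (V ≃ₗᵢ[ℝ] V)) : Set (Set V) :=
  {H | ∃ v : V, v ≠ 0 ∧ (ℝ ∙ v)ᗮ.reflection ∈ W ∧ H = ((ℝ ∙ v)ᗮ : Submodule ℝ V)}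

/-- The arrangement `𝒟` is stable under `W`. -/
def IsStable (W : Subgroup (V ≃ₗᵢ[ℝ] V)) (𝒟 : Set (Set V)) : Prop :=
  ∀ w ∈ W, ∀ H ∈ 𝒟, w '' H ∈ 𝒟

/-- The set of `W`-orbits of the chambers of `𝒟`, each orbit being a set of subsets of `V`. -/
def chamberOrbits (W : Subgroup (V ≃ₗᵢ[ℝ] V)) (𝒟 : Set (Set V)) : Set (Set (Set V)) :=
  {O | ∃ c ∈ chambers 𝒟, O = {c' | ∃ w ∈ W, c' = w '' c}}

/-- The isotropy subgroup `{w ∈ W | w b = b}` of `b`, as a subgroup of the isometry group. -/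
def isotropy (W : Subgroup (V ≃ₗᵢ[ℝ] V)) (b : Set V) : Subgroup (V ≃ₗᵢ[ℝ] V) where
  carrier := {w | w ∈ W ∧ w '' b = b}
  one_mem' := ⟨W.one_mem, by simp⟩
  mul_mem' := by
    rintro w₁ w₂ ⟨h₁, e₁⟩ ⟨h₂, e₂⟩
    refine ⟨W.mul_mem h₁ h₂, ?_⟩
    rw [LinearIsometryEquiv.coe_mul, Set.image_comp, e₂, e₁]
  inv_mem' := by
    rintro w ⟨h, e⟩
    refine ⟨W.inv_mem h, ?_⟩
    conv_lhs => rw [← e]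
    rw [← Set.image_comp, ← LinearIsometryEquiv.coe_mul, inv_mul_cancel]
    simp

end CoxeterStable

/-! All counts follow from two facts about the action of `W`. Freeness: only the identity fixes a
Coxeter chamber (`eq_one_of_image_eq`). Fix a point `x` of the chamber and a simple system for the
roots positive at `x`. If `w` keeps `x` on the same side of every wall, then `w⁻¹` keeps simple
roots positive, and the exchange property shortens any nonempty word for `w⁻¹` in simple
reflections, down to the empty word. Transitivity: for a chamber `b` of `ℬ`, the isotropy group of
`b` permutes transitively the chambers of the union inside `b`
(`exists_mem_component_of_mem_chamber`). Given sample points `x`, `y`, choose `w` in that group with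
`w y` closest to `x`. A mirror crossing the segment between them would meet it inside the convex set
`b`, so its reflection preserves `b` and brings `w y` closer to `x`, a contradiction. Hence the
isotropy group is simply transitive on the chambers inside `b`, which is (2); the case `ℬ = ∅` makes
`W` simply transitive on Coxeter chambers. For (1), the chambers inside `a` represent the `W`-orbits
of chambers of the union, and sending each to the chamber of `ℬ` around it gives a bijection onto
the orbits for `ℬ`. -/

namespace CoxeterStable

open scoped InnerProductSpace

/-! ### Unit roots and simple systems. -/

section Roots

variable {V : Type*} [NormedAddCommGroup V] [InnerProductSpace ℝ V]

/-- The orthogonal reflection in the hyperplane orthogonal to `v`. -/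
noncomputable abbrev hyperplaneReflection (v : V) : V ≃ₗᵢ[ℝ] V := (ℝ ∙ v)ᗮ.reflection

/-- The unit normal vectors of the reflecting hyperplanes of `W`. -/
def unitRoots (W : Subgroup (V ≃ₗᵢ[ℝ] V)) : Set V :=
  {v | ‖v‖ = 1 ∧ hyperplaneReflection v ∈ W}

theorem hyperplaneReflection_apply {v : V} (hv : ‖v‖ = 1) (x : V) :
    hyperplaneReflection v x = x - (2 * ⟪v, x⟫_ℝ) • v := by
  rw [hyperplaneReflection, Submodule.reflection_orthogonal_apply,
    Submodule.reflection_singleton_apply, hv]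
  simp only [RCLike.ofReal_real_eq_id, id, one_pow, div_one]
  module

theorem hyperplaneReflection_smul {r : ℝ} (hr : r ≠ 0) (v : V) :
    hyperplaneReflection (r • v) = hyperplaneReflection v := by
  have h : (ℝ ∙ (r • v)) = (ℝ ∙ v) := Submodule.span_singleton_smul_eq (IsUnit.mk0 r hr) v
  ext x
  simp only [hyperplaneReflection, Submodule.reflection_orthogonal_apply, h]

theorem hyperplaneReflection_neg (v : V) :
    hyperplaneReflection (-v) = hyperplaneReflection v := by
  rw [← neg_one_smul ℝ v, hyperplaneReflection_smul (by norm_num)]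

theorem hyperplaneReflection_self_mul (v : V) :
    hyperplaneReflection v * hyperplaneReflection v = 1 :=
  Submodule.reflection_mul_reflection _

theorem hyperplaneReflection_self (v : V) : hyperplaneReflection v v = -v :=
  Submodule.reflection_orthogonalComplement_singleton_eq_neg v

theorem hyperplaneReflection_map (w : V ≃ₗᵢ[ℝ] V) {v : V} (hv : ‖v‖ = 1) :
    hyperplaneReflection (w v) = w * hyperplaneReflection v * w⁻¹ := by
  ext x
  have hwv : ‖w v‖ = 1 := by rw [w.norm_map, hv]
  have h : ⟪w v, x⟫_ℝ = ⟪v, w⁻¹ x⟫_ℝ := by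
    rw [← w.inner_map_map v]
    exact congrArg _ (w.apply_symm_apply x).symm
  rw [hyperplaneReflection_apply hwv, h]
  change _ = w (hyperplaneReflection v (w⁻¹ x))
  rw [hyperplaneReflection_apply hv, map_sub, map_smul]
  congr 1
  exact (w.apply_symm_apply x).symm

variable {W : Subgroup (V ≃ₗᵢ[ℝ] V)}

theorem map_mem_unitRoots {w : V ≃ₗᵢ[ℝ] V} (hw : w ∈ W) {v : V} (hv : v ∈ unitRoots W) :
    w v ∈ unitRoots W := by
  refine ⟨by rw [w.norm_map, hv.1], ?_⟩
  rw [hyperplaneReflection_map w hv.1]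
  exact W.mul_mem (W.mul_mem hw hv.2) (W.inv_mem hw)

theorem neg_mem_unitRoots {v : V} (hv : v ∈ unitRoots W) : -v ∈ unitRoots W :=
  ⟨by rw [norm_neg, hv.1], by rw [hyperplaneReflection_neg]; exact hv.2⟩

theorem exists_unitRoot {v : V} (hv : v ≠ 0) (h : hyperplaneReflection v ∈ W) :
    ∃ r : ℝ, r ≠ 0 ∧ r • v ∈ unitRoots W := by
  have hn : ‖v‖⁻¹ ≠ 0 := inv_ne_zero (norm_ne_zero_iff.2 hv)
  refine ⟨‖v‖⁻¹, hn, ?_, ?_⟩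
  · rw [norm_smul, norm_inv, norm_norm, inv_mul_cancel₀ (norm_ne_zero_iff.2 hv)]
  · rw [hyperplaneReflection_smul hn]
    exact h

/-- A reflection determines its unit normal up to sign, so the fibres over the finite group have at
most two elements. -/
theorem finite_unitRoots [Finite W] : (unitRoots W).Finite := by
  have hW : (W : Set (V ≃ₗᵢ[ℝ] V)).Finite := Set.toFinite _
  refine Set.Finite.of_finite_fibers hyperplaneReflection
    (hW.subset (Set.image_subset_iff.2 fun v hv => hv.2)) ?_
  rintro s -
  by_cases hs : ∃ u ∈ unitRoots W, hyperplaneReflection u = s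
  · obtain ⟨u, hu, rfl⟩ := hs
    refine (Set.toFinite {u, -u}).subset ?_
    rintro v ⟨hv, hvu : hyperplaneReflection v = hyperplaneReflection u⟩
    have h1 : hyperplaneReflection u v = -v := by
      rw [← hvu, hyperplaneReflection_self]
    rw [hyperplaneReflection_apply hu.1] at h1
    have h2 : v = ⟪u, v⟫_ℝ • u := by
      have : (2 : ℝ) • v = (2 : ℝ) • (⟪u, v⟫_ℝ • u) := by
        rw [smul_smul]
        calc (2 : ℝ) • v = v + v := two_smul ℝ v
          _ = _ := by rw [sub_eq_iff_eq_add] at h1; nth_rewrite 1 [h1]; abel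
      exact smul_right_injective V (two_ne_zero : (2 : ℝ) ≠ 0) this
    have h3 : |⟪u, v⟫_ℝ| = 1 := by
      have := congrArg norm h2
      rwa [norm_smul, hv.1, hu.1, mul_one, Real.norm_eq_abs, eq_comm] at this
    rcases (abs_eq zero_le_one).1 h3 with h | h
    · left; rw [h2, h, one_smul]
    · right; rw [Set.mem_singleton_iff, h2, h, neg_one_smul]
  · refine Set.finite_empty.subset ?_
    rintro v ⟨hv, hvs⟩
    exact hs ⟨v, hv, hvs⟩

/-- `Δ` is a set of simple roots for the positive system of unit roots determined by `x`. -/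
structure IsSimpleSystem (W : Subgroup (V ≃ₗᵢ[ℝ] V)) (x : V) (Δ : Finset V) : Prop where
  mem_unitRoots : ∀ δ ∈ Δ, δ ∈ unitRoots W
  pos : ∀ δ ∈ Δ, 0 < ⟪δ, x⟫_ℝ
  exists_eq_sum : ∀ α ∈ unitRoots W, 0 < ⟪α, x⟫_ℝ →
    ∃ c : V → ℝ, (∀ v, 0 ≤ c v) ∧ α = ∑ γ ∈ Δ, c γ • γ
  ne_sum : ∀ δ ∈ Δ, ∀ c : V → ℝ, (∀ v, 0 ≤ c v) → ∀ Γ : Finset V,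
    (∀ γ, γ ∈ Γ ↔ γ ≠ δ ∧ γ ∈ Δ) → δ ≠ ∑ γ ∈ Γ, c γ • γ

/-- A set of positive roots of least cardinality whose nonnegative combinations give all positive
roots is irredundant. Irredundancy is all that is used later; linear independence is not needed. -/
theorem exists_isSimpleSystem [Finite W] (x : V) : ∃ Δ, IsSimpleSystem W x Δ := by
  classical
  let p : ℕ → Prop := fun n => ∃ Δ : Finset V, Δ.card = n ∧ (∀ δ ∈ Δ, δ ∈ unitRoots W) ∧
    (∀ δ ∈ Δ, 0 < ⟪δ, x⟫_ℝ) ∧ ∀ α ∈ unitRoots W, 0 < ⟪α, x⟫_ℝ →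
      ∃ c : V → ℝ, (∀ v, 0 ≤ c v) ∧ α = ∑ γ ∈ Δ, c γ • γ
  have hp : ∃ n, p n := by
    have hfin : {α | α ∈ unitRoots W ∧ 0 < ⟪α, x⟫_ℝ}.Finite :=
      finite_unitRoots.subset fun α h => h.1
    refine ⟨_, hfin.toFinset, rfl, fun δ h => (hfin.mem_toFinset.1 h).1,
      fun δ h => (hfin.mem_toFinset.1 h).2, fun α hα hx => ⟨fun v => if v = α then 1 else 0,
        fun v => by dsimp only; split_ifs <;> norm_num, ?_⟩⟩
    simp only [ite_smul, one_smul, zero_smul]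
    rw [Finset.sum_ite_eq', if_pos (hfin.mem_toFinset.2 ⟨hα, hx⟩)]
  obtain ⟨Δ, hcard, hroot, hpos, hrep⟩ := Nat.find_spec hp
  refine ⟨Δ, hroot, hpos, hrep, ?_⟩
  rintro δ hδ d hd Γ hΓ heq
  obtain rfl : Γ = Δ.erase δ := by ext γ; rw [hΓ, Finset.mem_erase]
  refine Nat.find_min hp (m := (Δ.erase δ).card)
    (hcard ▸ Finset.card_erase_lt_of_mem hδ) ⟨Δ.erase δ, rfl,
      fun γ h => hroot γ (Finset.mem_of_mem_erase h),
      fun γ h => hpos γ (Finset.mem_of_mem_erase h), fun α hα hx => ?_⟩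
  obtain ⟨c, hc, hsum⟩ := hrep α hα hx
  -- Substituting the combination for `δ` into that for `α` eliminates `δ`, against minimality.
  refine ⟨fun γ => c δ * d γ + c γ, fun γ => add_nonneg (mul_nonneg (hc _) (hd _)) (hc _), ?_⟩
  rw [hsum, ← Finset.add_sum_erase Δ _ hδ]
  conv_lhs => rw [heq]
  simp only [add_smul, Finset.sum_add_distrib, mul_smul, Finset.smul_sum]
  rw [← heq]

/-- `x` lies on none of the reflecting hyperplanes of `W`. -/
def IsRegular (W : Subgroup (V ≃ₗᵢ[ℝ] V)) (x : V) : Prop :=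
  ∀ α ∈ unitRoots W, ⟪α, x⟫_ℝ ≠ 0

/-! ### Exchange property and generation by simple reflections. -/

namespace IsSimpleSystem

variable {x : V} {Δ : Finset V}

/-- Reflecting in `δ` changes `α` only along `δ`. If the image were negative, the nonnegative
combinations for `α` and for minus its image would add up to a multiple of `δ`, which leaves only `α
= δ`. -/
theorem inner_reflection_pos (hΔ : IsSimpleSystem W x Δ) (hx : IsRegular W x) {δ α : V}
    (hδ : δ ∈ Δ) (hα : α ∈ unitRoots W) (hαx : 0 < ⟪α, x⟫_ℝ) (hne : α ≠ δ) :
    0 < ⟪hyperplaneReflection δ α, x⟫_ℝ := by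
  classical
  by_contra hneg
  have hδW := hΔ.mem_unitRoots δ hδ
  have hβ := map_mem_unitRoots hδW.2 hα
  have hlt : 0 < ⟪-(hyperplaneReflection δ α), x⟫_ℝ := by
    rw [inner_neg_left, neg_pos]
    exact lt_of_le_of_ne (not_lt.1 hneg) (hx _ hβ)
  obtain ⟨c, hc, hcs⟩ := hΔ.exists_eq_sum α hα hαx
  obtain ⟨d, hd, hds⟩ := hΔ.exists_eq_sum _ (neg_mem_unitRoots hβ) hlt
  set k := 2 * ⟪δ, α⟫_ℝ with hk
  have hsum : k • δ = ∑ γ ∈ Δ, (c γ + d γ) • γ := by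
    simp only [add_smul, Finset.sum_add_distrib]
    rw [← hcs, ← hds, hyperplaneReflection_apply hδW.1]
    abel
  rw [← Finset.add_sum_erase Δ _ hδ] at hsum
  set r := k - (c δ + d δ) with hr
  have hsum' : r • δ = ∑ γ ∈ Δ.erase δ, (c γ + d γ) • γ := by
    rw [hr, sub_smul, hsum]; abel
  -- If `r > 0`, dividing by `r` makes `δ` redundant. If `r ≤ 0`, pairing with `x` forces every
  -- other coefficient to vanish, so `α` is a multiple of `δ`.
  rcases lt_or_ge 0 r with hrpos | hrneg
  · refine hΔ.ne_sum δ hδ (fun γ => r⁻¹ * (c γ + d γ))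
      (fun γ => mul_nonneg (inv_nonneg.2 hrpos.le) (add_nonneg (hc _) (hd _))) (Δ.erase δ)
      (fun γ => Finset.mem_erase) ?_
    simp only [mul_smul]
    rw [← Finset.smul_sum, ← hsum', smul_smul, inv_mul_cancel₀ hrpos.ne', one_smul]
  · have h0 : ∀ γ ∈ Δ.erase δ, 0 ≤ (c γ + d γ) * ⟪γ, x⟫_ℝ := fun γ hγ =>
      mul_nonneg (add_nonneg (hc _) (hd _)) (hΔ.pos γ (Finset.mem_of_mem_erase hγ)).le
    have h1 : ∑ γ ∈ Δ.erase δ, (c γ + d γ) * ⟪γ, x⟫_ℝ ≤ 0 := by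
      have := congrArg (fun v => ⟪v, x⟫_ℝ) hsum'
      simp only [sum_inner, inner_smul_left, RCLike.conj_to_real] at this
      rw [← this]
      exact mul_nonpos_of_nonpos_of_nonneg hrneg (hΔ.pos δ hδ).le
    have h2 := (Finset.sum_eq_zero_iff_of_nonneg h0).1 (le_antisymm h1 (Finset.sum_nonneg h0))
    have h3 : ∀ γ ∈ Δ.erase δ, c γ = 0 := fun γ hγ => by
      have h := (mul_eq_zero.1 (h2 γ hγ)).resolve_right
        (hΔ.pos γ (Finset.mem_of_mem_erase hγ)).ne'
      linarith [hc γ, hd γ]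
    have h4 : α = c δ • δ := by
      rw [hcs, ← Finset.add_sum_erase Δ _ hδ,
        Finset.sum_eq_zero fun γ hγ => by rw [h3 γ hγ, zero_smul], add_zero]
    have h5 : c δ = 1 := by
      have := congrArg norm h4
      rw [norm_smul, hα.1, hδW.1, mul_one, Real.norm_of_nonneg (hc δ)] at this
      exact this.symm
    exact hne (by rw [h4, h5, one_smul])

/-- The exchange property for words in simple reflections. -/
theorem exists_exchange (hΔ : IsSimpleSystem W x Δ) (hx : IsRegular W x) {δ : V} (hδ : δ ∈ Δ)
    (L : List V) (hL : ∀ γ ∈ L, γ ∈ Δ)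
    (hneg : ⟪(L.map hyperplaneReflection).prod δ, x⟫_ℝ < 0) :
    ∃ L' : List V, (∀ γ ∈ L', γ ∈ Δ) ∧ L'.length < L.length ∧
      (L.map hyperplaneReflection).prod * hyperplaneReflection δ =
        (L'.map hyperplaneReflection).prod := by
  induction L with
  | nil => exact absurd (hΔ.pos δ hδ) (not_lt.2 hneg.le)
  | cons γ L ih =>
    have hγ := hL γ List.mem_cons_self
    have hL' : ∀ η ∈ L, η ∈ Δ := fun η h => hL η (List.mem_cons_of_mem _ h)
    set u := (L.map hyperplaneReflection).prod with hu
    have huW : u ∈ W := by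
      refine W.list_prod_mem fun s hs => ?_
      obtain ⟨η, hη, rfl⟩ := List.mem_map.1 hs
      exact (hΔ.mem_unitRoots η (hL' η hη)).2
    have hroot := map_mem_unitRoots huW (hΔ.mem_unitRoots δ hδ)
    rw [List.map_cons, List.prod_cons, ← hu] at hneg ⊢
    -- If `u δ` is already negative, a letter is removed from the tail. Otherwise the reflection in
    -- `γ` turns the positive root `u δ` negative, so `u δ = γ`; then that reflection is the
    -- conjugate by `u` of the one in `δ`, and the product collapses to `u`.
    rcases lt_or_gt_of_ne (hx _ hroot) with h | h
    · obtain ⟨L', h1, h2, h3⟩ := ih hL' h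
      refine ⟨γ :: L', ?_, by simpa using h2, ?_⟩
      · intro η hη
        rcases List.mem_cons.1 hη with rfl | hη
        exacts [hγ, h1 η hη]
      · rw [List.map_cons, List.prod_cons, mul_assoc, h3]
    · refine ⟨L, hL', by simp, ?_⟩
      have hEq : u δ = γ := by
        by_contra hne
        exact absurd (hΔ.inner_reflection_pos hx hγ hroot h hne) (not_lt.2 hneg.le)
      rw [← hEq, hyperplaneReflection_map u (hΔ.mem_unitRoots δ hδ).1]
      simp only [mul_assoc, inv_mul_cancel_left, hyperplaneReflection_self_mul, mul_one, ← hu]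

/-- Descent on the length: if the word ends in `δ`, then, since its product keeps `δ` positive, the
remaining prefix sends `δ` to a negative root, and exchange gives a shorter word with the same
product. -/
theorem prod_eq_one (hΔ : IsSimpleSystem W x Δ) (hx : IsRegular W x) (n : ℕ) :
    ∀ L : List V, L.length = n → (∀ γ ∈ L, γ ∈ Δ) →
      (∀ α ∈ Δ, 0 < ⟪(L.map hyperplaneReflection).prod α, x⟫_ℝ) →
      (L.map hyperplaneReflection).prod = 1 := by
  induction n using Nat.strong_induction_on with
  | _ n ih =>
    intro L hn hL hpos
    rcases L.eq_nil_or_concat with rfl | ⟨L, δ, rfl⟩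
    · rfl
    · rw [List.concat_eq_append] at *
      have hδ : δ ∈ Δ := hL δ (by simp)
      have hprod : ((L ++ [δ]).map hyperplaneReflection).prod =
          (L.map hyperplaneReflection).prod * hyperplaneReflection δ := by simp
      have hneg : ⟪(L.map hyperplaneReflection).prod δ, x⟫_ℝ < 0 := by
        have h := hpos δ hδ
        rw [hprod] at h
        change 0 < ⟪(L.map hyperplaneReflection).prod (hyperplaneReflection δ δ), x⟫_ℝ at h
        rw [hyperplaneReflection_self, map_neg, inner_neg_left] at h
        linarith
      obtain ⟨L', h1, h2, h3⟩ := hΔ.exists_exchange hx hδ L (fun γ h => hL γ (by simp [h])) hneg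
      have hlen : (L ++ [δ]).length = L.length + 1 := by simp
      rw [hprod, h3] at hpos ⊢
      exact ih L'.length (by omega) L' rfl h1 hpos

/-- Among the positive roots in the `W₀`-orbit of `α`, take one of least height `⟪β, x⟫`. Some
simple `γ` pairs positively with it, and reflecting in `γ` would lower the height within the
positive roots unless the root is `γ` itself. So `α` is conjugate under `W₀` to a simple root. -/
theorem unitRoots_reflection_mem_closure [Finite W] (hΔ : IsSimpleSystem W x Δ)
    (hx : IsRegular W x) {α : V} (hα : α ∈ unitRoots W) :
    hyperplaneReflection α ∈ Subgroup.closure (hyperplaneReflection '' (Δ : Set V)) := by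
  set W₀ := Subgroup.closure (hyperplaneReflection '' (Δ : Set V)) with hW₀
  have hle : W₀ ≤ W := by
    rw [hW₀, Subgroup.closure_le]
    rintro _ ⟨δ, hδ, rfl⟩
    exact (hΔ.mem_unitRoots δ hδ).2
  suffices h : ∀ α' ∈ unitRoots W, 0 < ⟪α', x⟫_ℝ → hyperplaneReflection α' ∈ W₀ by
    rcases lt_or_gt_of_ne (hx α hα) with h' | h'
    · rw [← hyperplaneReflection_neg]
      exact h _ (neg_mem_unitRoots hα) (by rwa [inner_neg_left, neg_pos])
    · exact h α hα h'
  intro α hα hαx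
  let S : Set V := {β | 0 < ⟪β, x⟫_ℝ ∧ ∃ u ∈ W₀, β = u α}
  have hS : S ⊆ unitRoots W := by
    rintro _ ⟨-, u, hu, rfl⟩
    exact map_mem_unitRoots (hle hu) hα
  obtain ⟨β, ⟨hβx, u, hu, rfl⟩, hmin⟩ := Set.exists_min_image S (fun β => ⟪β, x⟫_ℝ)
    (finite_unitRoots.subset hS) ⟨α, hαx, 1, W₀.one_mem, rfl⟩
  have hβ : u α ∈ unitRoots W := map_mem_unitRoots (hle hu) hα
  have hγ : ∃ γ ∈ Δ, 0 < ⟪γ, u α⟫_ℝ := by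
    by_contra! hcon
    obtain ⟨c, hc, hsum⟩ := hΔ.exists_eq_sum _ hβ hβx
    have h1 : ⟪u α, u α⟫_ℝ ≤ 0 := by
      nth_rewrite 1 [hsum]
      rw [sum_inner]
      refine Finset.sum_nonpos fun γ hγ => ?_
      rw [inner_smul_left]
      exact mul_nonpos_of_nonneg_of_nonpos (hc γ) (hcon γ hγ)
    rw [real_inner_self_eq_norm_sq, hβ.1] at h1
    norm_num at h1
  obtain ⟨γ, hγ, hγβ⟩ := hγ
  have hγ₀ : hyperplaneReflection γ ∈ W₀ := Subgroup.subset_closure ⟨γ, hγ, rfl⟩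
  have hEq : u α = γ := by
    by_contra hne
    have h1 := hΔ.inner_reflection_pos hx hγ hβ hβx hne
    have h2 := hmin _ ⟨h1, hyperplaneReflection γ * u, W₀.mul_mem hγ₀ hu, rfl⟩
    simp only [hyperplaneReflection_apply (hΔ.mem_unitRoots γ hγ).1, inner_sub_left,
      inner_smul_left, RCLike.conj_to_real] at h2
    nlinarith [mul_pos hγβ (hΔ.pos γ hγ)]
  have h3 : hyperplaneReflection α = u⁻¹ * hyperplaneReflection γ * u⁻¹⁻¹ := by
    rw [← hyperplaneReflection_map u⁻¹ (hΔ.mem_unitRoots γ hγ).1, ← hEq]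
    exact congrArg _ (u.symm_apply_apply α).symm
  rw [h3]
  exact W₀.mul_mem (W₀.mul_mem (W₀.inv_mem hu) hγ₀) (W₀.inv_mem (W₀.inv_mem hu))

theorem exists_list_eq_prod (hW : IsFiniteReflectionGroup W) (hΔ : IsSimpleSystem W x Δ)
    (hx : IsRegular W x) {w : V ≃ₗᵢ[ℝ] V} (hw : w ∈ W) :
    ∃ L : List V, (∀ γ ∈ L, γ ∈ Δ) ∧ (L.map hyperplaneReflection).prod = w := by
  have := hW.1
  have hmem : w ∈ Subgroup.closure (hyperplaneReflection '' (Δ : Set V)) := by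
    rw [← hW.2] at hw
    refine (Subgroup.closure_le _).2 ?_ hw
    rintro _ ⟨hs, v, hv, rfl⟩
    obtain ⟨r, hr, hroot⟩ := exists_unitRoot hv hs
    have h := hΔ.unitRoots_reflection_mem_closure hx hroot
    rwa [hyperplaneReflection_smul hr] at h
  have hgen : ∀ s ∈ hyperplaneReflection '' (Δ : Set V), s⁻¹ = s := by
    rintro _ ⟨γ, -, rfl⟩
    exact Submodule.reflection_inv
  induction hmem using Subgroup.closure_induction with
  | mem s hs =>
    obtain ⟨γ, hγ, rfl⟩ := hs
    exact ⟨[γ], by simpa using hγ, by simp⟩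
  | one => exact ⟨[], by simp, rfl⟩
  | mul a b ha hb iha ihb =>
    have hle : Subgroup.closure (hyperplaneReflection '' (Δ : Set V)) ≤ W := by
      rw [Subgroup.closure_le]
      rintro _ ⟨δ, hδ, rfl⟩
      exact (hΔ.mem_unitRoots δ hδ).2
    obtain ⟨L, hL, rfl⟩ := iha (hle ha)
    obtain ⟨M, hM, rfl⟩ := ihb (hle hb)
    refine ⟨L ++ M, fun γ hγ => ?_, by simp⟩
    rcases List.mem_append.1 hγ with h | h
    exacts [hL γ h, hM γ h]
  | inv a ha iha =>
    obtain ⟨L, hL, rfl⟩ := iha (by simpa using W.inv_mem hw)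
    refine ⟨L.reverse, fun γ hγ => hL γ (List.mem_reverse.1 hγ), ?_⟩
    rw [List.prod_inv_reverse, List.map_map, ← List.map_reverse]
    refine congrArg _ (List.map_congr_left fun γ hγ => ?_)
    exact Submodule.reflection_inv.symm

end IsSimpleSystem

/-- An element of a finite reflection group which maps a regular point to a point on the same side
of every reflecting hyperplane is trivial. -/
theorem eq_one_of_inner_pos (hW : IsFiniteReflectionGroup W) {x : V} (hx : IsRegular W x)
    {w : V ≃ₗᵢ[ℝ] V} (hw : w ∈ W)
    (h : ∀ α ∈ unitRoots W, 0 < ⟪α, x⟫_ℝ → 0 < ⟪α, w x⟫_ℝ) : w = 1 := by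
  have := hW.1
  obtain ⟨Δ, hΔ⟩ := exists_isSimpleSystem (W := W) x
  -- The word spells `w⁻¹`, because `⟪w⁻¹ α, x⟫ = ⟪α, w x⟫`.
  obtain ⟨L, hL, hLw⟩ := hΔ.exists_list_eq_prod hW hx (W.inv_mem hw)
  have h1 := hΔ.prod_eq_one hx _ L rfl hL fun α hα => by
    rw [hLw, ← w.inner_map_map]
    have : w (w⁻¹ α) = α := w.apply_symm_apply α
    rw [this]
    exact h α (hΔ.mem_unitRoots α hα) (hΔ.pos α hα)
  rw [hLw] at h1
  exact inv_eq_one.1 h1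

end Roots

end CoxeterStable

namespace CoxeterStable

open scoped InnerProductSpace

/-! ### Convexity, finiteness and density for chambers. -/

section Chambers

variable {V : Type*} [NormedAddCommGroup V] {𝒟 : Set (Set V)}

theorem chambers_subset_compl {c : Set V} (hc : c ∈ chambers 𝒟) : c ⊆ (⋃₀ 𝒟)ᶜ := by
  obtain ⟨x, -, rfl⟩ := hc
  exact connectedComponentIn_subset _ _

theorem chambers_nonempty {c : Set V} (hc : c ∈ chambers 𝒟) : c.Nonempty := by
  obtain ⟨x, hx, rfl⟩ := hc
  exact ⟨x, mem_connectedComponentIn hx⟩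

theorem chambers_eq_component {c : Set V} (hc : c ∈ chambers 𝒟) {y : V} (hy : y ∈ c) :
    c = connectedComponentIn (⋃₀ 𝒟)ᶜ y := by
  obtain ⟨x, -, rfl⟩ := hc
  exact connectedComponentIn_eq hy

theorem chambers_eq_of_mem {c d : Set V} (hc : c ∈ chambers 𝒟) (hd : d ∈ chambers 𝒟) {y : V}
    (hyc : y ∈ c) (hyd : y ∈ d) : c = d := by
  rw [chambers_eq_component hc hyc, ← chambers_eq_component hd hyd]

theorem exists_chamber_superset {ℰ : Set (Set V)} (h : 𝒟 ⊆ ℰ) {c : Set V}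
    (hc : c ∈ chambers ℰ) : ∃ d ∈ chambers 𝒟, c ⊆ d := by
  have hsub : (⋃₀ ℰ)ᶜ ⊆ (⋃₀ 𝒟)ᶜ := Set.compl_subset_compl.2 (Set.sUnion_subset_sUnion h)
  obtain ⟨x, hx, rfl⟩ := hc
  exact ⟨_, ⟨x, hsub hx, rfl⟩, connectedComponentIn_mono x hsub⟩

theorem subset_chamber_of_mem {ℰ : Set (Set V)} (h : 𝒟 ⊆ ℰ) {c d : Set V}
    (hc : c ∈ chambers ℰ) (hd : d ∈ chambers 𝒟) {y : V} (hyc : y ∈ c) (hyd : y ∈ d) : c ⊆ d := by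
  obtain ⟨d', hd', hcd'⟩ := exists_chamber_superset h hc
  rwa [chambers_eq_of_mem hd hd' hyd (hcd' hyc)]

variable [InnerProductSpace ℝ V]

/-- A linear functional maps the connected component onto an interval, so a hyperplane separating
two of its points would have to meet it. This makes chambers convex. -/
theorem mem_connectedComponentIn_iff_segment (h𝒟 : ∀ H ∈ 𝒟, IsHyperplane H) {x y : V} :
    y ∈ connectedComponentIn (⋃₀ 𝒟)ᶜ x ↔ segment ℝ x y ⊆ (⋃₀ 𝒟)ᶜ := by
  constructor
  · intro hy
    have hx : x ∈ (⋃₀ 𝒟)ᶜ := connectedComponentIn_nonempty_iff.1 ⟨y, hy⟩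
    rintro p hp ⟨H, hH, hpH⟩
    obtain ⟨v, -, t, rfl⟩ := h𝒟 H hH
    have himage : IsPreconnected ((fun z => ⟪v, z⟫_ℝ) '' connectedComponentIn (⋃₀ 𝒟)ᶜ x) :=
      isPreconnected_connectedComponentIn.image _
        (continuous_const.inner continuous_id).continuousOn
    have hconv : Convex ℝ ((fun z => ⟪v, z⟫_ℝ) '' connectedComponentIn (⋃₀ 𝒟)ᶜ x) :=
      himage.ordConnected.convex
    have hmem := hconv.segment_subset ⟨x, mem_connectedComponentIn hx, rfl⟩ ⟨y, hy, rfl⟩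
    have hpmem : ⟪v, p⟫_ℝ ∈ segment ℝ ⟪v, x⟫_ℝ ⟪v, y⟫_ℝ := by
      obtain ⟨a, b, ha, hb, hab, rfl⟩ := hp
      exact ⟨a, b, ha, hb, hab, by simp [inner_add_right, inner_smul_right]⟩
    -- `p` is not known to lie in the component, but some `z` of the component has the same value
    -- and hence lies on the same hyperplane.
    obtain ⟨z, hz, hzp⟩ := hmem hpmem
    exact connectedComponentIn_subset _ _ hz ⟨_, hH, hzp.trans hpH⟩
  · intro h
    exact (convex_segment x y).isPreconnected.subset_connectedComponentIn
      (left_mem_segment ℝ x y) h (right_mem_segment ℝ x y)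

theorem chambers_segment_subset (h𝒟 : ∀ H ∈ 𝒟, IsHyperplane H) {c : Set V}
    (hc : c ∈ chambers 𝒟) {x y : V} (hx : x ∈ c) (hy : y ∈ c) : segment ℝ x y ⊆ c := by
  rw [chambers_eq_component hc hx] at hy ⊢
  exact (convex_segment x y).isPreconnected.subset_connectedComponentIn
    (left_mem_segment ℝ x y) ((mem_connectedComponentIn_iff_segment h𝒟).1 hy)

/-- A chamber is determined by the subset of hyperplanes on whose positive side it lies. -/
theorem finite_chambers (h𝒟 : IsArrangement 𝒟) : (chambers 𝒟).Finite := by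
  choose! v _ t hvt using h𝒟.2
  refine Set.Finite.of_finite_image (f := fun c : Set V => {H | H ∈ 𝒟 ∧ ∃ y ∈ c, t H < ⟪v H, y⟫_ℝ})
    (h𝒟.1.finite_subsets.subset ?_) ?_
  · rintro _ ⟨c, -, rfl⟩
    exact fun H hH => hH.1
  · intro c hc d hd hcd
    obtain ⟨x, hx⟩ := chambers_nonempty hc
    obtain ⟨y, hy⟩ := chambers_nonempty hd
    have key : ∀ c ∈ chambers 𝒟, ∀ x ∈ c, ∀ H ∈ 𝒟,
        (∃ y ∈ c, t H < ⟪v H, y⟫_ℝ) → t H < ⟪v H, x⟫_ℝ := by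
      rintro c hc x hx H hH ⟨y, hy, hlt⟩
      by_contra hle
      have hconv : Convex ℝ ((fun z => ⟪v H, z⟫_ℝ) '' c) := by
        have hpre : IsPreconnected c := by
          rw [chambers_eq_component hc hx]
          exact isPreconnected_connectedComponentIn
        exact (hpre.image _
          (continuous_const.inner continuous_id).continuousOn).ordConnected.convex
      obtain ⟨z, hz, hzt⟩ := hconv.ordConnected.out ⟨x, hx, rfl⟩ ⟨y, hy, rfl⟩
        ⟨not_lt.1 hle, hlt.le⟩
      refine chambers_subset_compl hc hz ⟨H, hH, ?_⟩
      rw [hvt H hH]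
      exact hzt
    have hmem : y ∈ connectedComponentIn (⋃₀ 𝒟)ᶜ x := by
      rw [mem_connectedComponentIn_iff_segment h𝒟.2]
      rintro p ⟨a, b, ha, hb, hab, rfl⟩ ⟨H, hH, hp⟩
      have hxne : ⟪v H, x⟫_ℝ ≠ t H := fun h => chambers_subset_compl hc hx
        ⟨H, hH, by rw [hvt H hH]; exact h⟩
      have hyne : ⟪v H, y⟫_ℝ ≠ t H := fun h => chambers_subset_compl hd hy
        ⟨H, hH, by rw [hvt H hH]; exact h⟩
      rw [hvt H hH] at hp
      simp only [Set.mem_ofPred_eq, inner_add_right, inner_smul_right] at hp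
      have hiff : t H < ⟪v H, x⟫_ℝ ↔ t H < ⟪v H, y⟫_ℝ := by
        have hset : (H ∈ 𝒟 ∧ ∃ y ∈ c, t H < ⟪v H, y⟫_ℝ) ↔ (H ∈ 𝒟 ∧ ∃ y ∈ d, t H < ⟪v H, y⟫_ℝ) :=
          Set.ext_iff.1 hcd H
        exact ⟨fun h => key d hd y hy H hH (hset.1 ⟨hH, x, hx, h⟩).2,
          fun h => key c hc x hx H hH (hset.2 ⟨hH, y, hy, h⟩).2⟩
      -- The offsets of `x` and `y` from `H` are nonzero with the same sign, so no convex
      -- combination of them vanishes.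
      have hcomb : a * (⟪v H, x⟫_ℝ - t H) + b * (⟪v H, y⟫_ℝ - t H) = 0 := by
        linear_combination hp - t H * hab
      rcases lt_or_gt_of_ne hxne with h | h
      · have h' : ⟪v H, y⟫_ℝ < t H :=
          lt_of_le_of_ne (not_lt.1 fun h' => absurd (hiff.2 h') h.not_gt) hyne
        rcases ha.lt_or_eq with ha' | rfl
        · nlinarith [mul_pos ha' (sub_pos.2 h), mul_nonneg hb (sub_pos.2 h').le]
        · nlinarith
      · have h' := hiff.1 h
        rcases ha.lt_or_eq with ha' | rfl
        · nlinarith [mul_pos ha' (sub_pos.2 h), mul_nonneg hb (sub_pos.2 h').le]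
        · nlinarith
    rw [chambers_eq_component hc hx, connectedComponentIn_eq hmem, ← chambers_eq_component hd hy]

theorem IsHyperplane.isClosed {H : Set V} (hH : IsHyperplane H) : IsClosed H := by
  obtain ⟨v, -, t, rfl⟩ := hH
  exact isClosed_eq (continuous_const.inner continuous_id) continuous_const

theorem IsHyperplane.dense_compl {H : Set V} (hH : IsHyperplane H) : Dense Hᶜ := by
  obtain ⟨v, hv, t, rfl⟩ := hH
  rw [Metric.dense_iff]
  intro x r hr
  by_cases hx : ⟪v, x⟫_ℝ = t
  · have hvn : 0 < ‖v‖ := norm_pos_iff.2 hv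
    have hs : 0 < r / (2 * ‖v‖) := by positivity
    refine ⟨x + (r / (2 * ‖v‖)) • v, ?_, ?_⟩
    · rw [Metric.mem_ball, dist_self_add_left, norm_smul, Real.norm_of_nonneg hs.le]
      have : r / (2 * ‖v‖) * ‖v‖ = r / 2 := by field_simp
      linarith
    · simp only [Set.mem_compl_iff, Set.mem_ofPred_eq, inner_add_right, inner_smul_right, hx]
      have : 0 < r / (2 * ‖v‖) * ⟪v, v⟫_ℝ := mul_pos hs (real_inner_self_pos.2 hv)
      linarith
  · exact ⟨x, Metric.mem_ball_self hr, hx⟩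

theorem IsArrangement.isOpen_compl (h𝒟 : IsArrangement 𝒟) : IsOpen (⋃₀ 𝒟)ᶜ :=
  (Set.sUnion_eq_biUnion ▸
    h𝒟.1.isClosed_biUnion fun H hH => (h𝒟.2 H hH).isClosed).isOpen_compl

theorem IsArrangement.dense_compl (h𝒟 : IsArrangement 𝒟) : Dense (⋃₀ 𝒟)ᶜ := by
  obtain ⟨hfin, hhyp⟩ := h𝒟
  induction 𝒟, hfin using Set.Finite.induction_on with
  | empty => simp
  | insert _ hfin ih =>
    rw [Set.sUnion_insert, Set.compl_union]
    exact (hhyp _ (Set.mem_insert _ _)).dense_compl.inter_of_isOpen_left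
      (ih fun H hH => hhyp H (Set.mem_insert_of_mem _ hH))
      (hhyp _ (Set.mem_insert _ _)).isClosed.isOpen_compl

/-- The chamber `d` is open and the complement of a finite union of hyperplanes is dense. -/
theorem exists_chamber_subset {ℰ : Set (Set V)} (h𝒟 : IsArrangement 𝒟) (hℰ : IsArrangement ℰ)
    (h : 𝒟 ⊆ ℰ) {d : Set V} (hd : d ∈ chambers 𝒟) : ∃ c ∈ chambers ℰ, c ⊆ d := by
  have hopen : IsOpen d := by
    obtain ⟨x, -, rfl⟩ := hd
    exact h𝒟.isOpen_compl.connectedComponentIn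
  obtain ⟨y, hyd, hy⟩ := hℰ.dense_compl.inter_open_nonempty d hopen (chambers_nonempty hd)
  have hc : connectedComponentIn (⋃₀ ℰ)ᶜ y ∈ chambers ℰ := ⟨y, hy, rfl⟩
  exact ⟨_, hc, subset_chamber_of_mem h hc hd (mem_connectedComponentIn hy) hyd⟩

/-! ### The action of `W` on chambers. -/

variable {W : Subgroup (V ≃ₗᵢ[ℝ] V)}

theorem image_mul (u w : V ≃ₗᵢ[ℝ] V) (s : Set V) : (u * w) '' s = u '' (w '' s) := by
  rw [LinearIsometryEquiv.coe_mul, Set.image_comp]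

theorem inv_image_image (w : V ≃ₗᵢ[ℝ] V) (s : Set V) : (w⁻¹ : V ≃ₗᵢ[ℝ] V) '' (w '' s) = s := by
  rw [← image_mul, inv_mul_cancel]
  exact Set.image_id s

theorem image_inv_image (w : V ≃ₗᵢ[ℝ] V) (s : Set V) : w '' ((w⁻¹ : V ≃ₗᵢ[ℝ] V) '' s) = s := by
  rw [← image_mul, mul_inv_cancel]
  exact Set.image_id s

theorem IsStable.image_compl (h𝒟 : IsStable W 𝒟) {w : V ≃ₗᵢ[ℝ] V} (hw : w ∈ W) :
    w '' (⋃₀ 𝒟)ᶜ = (⋃₀ 𝒟)ᶜ := by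
  have hsub : ∀ u ∈ W, u '' ⋃₀ 𝒟 ⊆ ⋃₀ 𝒟 := by
    rintro u hu _ ⟨x, ⟨H, hH, hx⟩, rfl⟩
    exact ⟨_, h𝒟 u hu H hH, x, hx, rfl⟩
  rw [Set.image_compl_eq w.bijective]
  congr 1
  refine (hsub w hw).antisymm ?_
  have h := Set.image_mono (f := w) (hsub _ (W.inv_mem hw))
  rwa [image_inv_image] at h

theorem IsStable.image_mem_chambers (h𝒟 : IsStable W 𝒟) {w : V ≃ₗᵢ[ℝ] V} (hw : w ∈ W)
    {c : Set V} (hc : c ∈ chambers 𝒟) : w '' c ∈ chambers 𝒟 := by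
  obtain ⟨x, hx, rfl⟩ := hc
  have h1 := h𝒟.image_compl hw
  refine ⟨w x, h1 ▸ ⟨x, hx, rfl⟩, ?_⟩
  have h2 := w.toHomeomorph.image_connectedComponentIn hx
  change w '' _ = connectedComponentIn (w '' (⋃₀ 𝒟)ᶜ) (w x) at h2
  rw [h2, h1]

theorem mem_coxeterArrangement_iff {H : Set V} :
    H ∈ coxeterArrangement W ↔ ∃ α ∈ unitRoots W, H = {x | ⟪α, x⟫_ℝ = 0} := by
  have hset : ∀ v : V, (((ℝ ∙ v)ᗮ : Submodule ℝ V) : Set V) = {x | ⟪v, x⟫_ℝ = 0} := fun v => by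
    ext x
    exact Submodule.mem_orthogonal_singleton_iff_inner_right
  constructor
  · rintro ⟨v, hv, hvW, rfl⟩
    obtain ⟨r, hr, hroot⟩ := exists_unitRoot hv hvW
    refine ⟨_, hroot, ?_⟩
    rw [hset]
    ext x
    simp [inner_smul_left, hr]
  · rintro ⟨α, hα, rfl⟩
    exact ⟨α, fun h => by simpa [h] using hα.1, hα.2, (hset α).symm⟩

theorem isArrangement_coxeterArrangement [Finite W] : IsArrangement (coxeterArrangement W) := by
  constructor
  · refine ((finite_unitRoots (W := W)).image fun α => {x : V | ⟪α, x⟫_ℝ = 0}).subset ?_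
    intro H hH
    obtain ⟨α, hα, rfl⟩ := mem_coxeterArrangement_iff.1 hH
    exact ⟨α, hα, rfl⟩
  · intro H hH
    obtain ⟨α, hα, rfl⟩ := mem_coxeterArrangement_iff.1 hH
    exact ⟨α, fun h => by simpa [h] using hα.1, 0, rfl⟩

theorem isStable_coxeterArrangement : IsStable W (coxeterArrangement W) := by
  intro w hw H hH
  obtain ⟨α, hα, rfl⟩ := mem_coxeterArrangement_iff.1 hH
  refine mem_coxeterArrangement_iff.2 ⟨w α, map_mem_unitRoots hw hα, ?_⟩
  ext x
  constructor
  · rintro ⟨y, hy, rfl⟩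
    exact (w.inner_map_map α y).trans hy
  · intro hx
    refine ⟨w.symm x, ?_, w.apply_symm_apply x⟩
    change ⟪α, w.symm x⟫_ℝ = 0
    rw [← w.inner_map_map, w.apply_symm_apply]
    exact hx

theorem IsStable.union {ℰ : Set (Set V)} (h𝒟 : IsStable W 𝒟) (hℰ : IsStable W ℰ) :
    IsStable W (𝒟 ∪ ℰ) := by
  rintro w hw H (hH | hH)
  exacts [Or.inl (h𝒟 w hw H hH), Or.inr (hℰ w hw H hH)]

theorem IsArrangement.union {ℰ : Set (Set V)} (h𝒟 : IsArrangement 𝒟) (hℰ : IsArrangement ℰ) :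
    IsArrangement (𝒟 ∪ ℰ) :=
  ⟨h𝒟.1.union hℰ.1, fun H hH => hH.elim (h𝒟.2 H) (hℰ.2 H)⟩

theorem isRegular_of_mem_compl {x : V} (hx : x ∈ (⋃₀ coxeterArrangement W)ᶜ) : IsRegular W x :=
  fun α hα h => hx ⟨_, mem_coxeterArrangement_iff.2 ⟨α, hα, rfl⟩, h⟩

/-- The group acts freely on the chambers of its Coxeter arrangement. -/
theorem eq_one_of_image_eq (hW : IsFiniteReflectionGroup W) {a : Set V}
    (ha : a ∈ chambers (coxeterArrangement W)) {w : V ≃ₗᵢ[ℝ] V} (hw : w ∈ W)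
    (h : w '' a = a) : w = 1 := by
  have := hW.1
  obtain ⟨x, hx⟩ := chambers_nonempty ha
  refine eq_one_of_inner_pos hW (isRegular_of_mem_compl (chambers_subset_compl ha hx)) hw ?_
  intro α hα hpos
  by_contra hneg
  have hwx : w x ∈ a := h ▸ ⟨x, hx, rfl⟩
  have hpre : IsPreconnected a := by
    rw [chambers_eq_component ha hx]
    exact isPreconnected_connectedComponentIn
  have hconv := (hpre.image (fun z => ⟪α, z⟫_ℝ)
    (continuous_const.inner continuous_id).continuousOn).ordConnected
  obtain ⟨z, hz, hz0⟩ := hconv.out ⟨w x, hwx, rfl⟩ ⟨x, hx, rfl⟩ ⟨not_lt.1 hneg, hpos.le⟩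
  exact isRegular_of_mem_compl (chambers_subset_compl ha hz) α hα hz0

/-- Within a chamber `b` of a stable arrangement, the isotropy group of `b` is transitive on the
chambers of the union with the Coxeter arrangement. -/
theorem exists_mem_component_of_mem_chamber [Finite W] (h𝒟 : ∀ H ∈ 𝒟, IsHyperplane H)
    (hs : IsStable W 𝒟) {b : Set V} (hb : b ∈ chambers 𝒟) {x y : V} (hx : x ∈ b) (hy : y ∈ b)
    (hxr : IsRegular W x) (hyr : IsRegular W y) :
    ∃ w ∈ W, w '' b = b ∧ w y ∈ connectedComponentIn (⋃₀ (coxeterArrangement W ∪ 𝒟))ᶜ x := by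
  have hWfin : (W : Set (V ≃ₗᵢ[ℝ] V)).Finite := Set.toFinite _
  obtain ⟨w, ⟨hw, hwb⟩, hmin⟩ := Set.exists_min_image {w | w ∈ W ∧ w '' b = b}
    (fun w => ‖w y - x‖ ^ 2) (hWfin.subset fun w h => h.1) ⟨1, W.one_mem, Set.image_id b⟩
  have hwy : w y ∈ b := hwb ▸ ⟨y, hy, rfl⟩
  refine ⟨w, hw, hwb, ?_⟩
  rw [mem_connectedComponentIn_iff_segment fun H hH =>
    hH.elim (isArrangement_coxeterArrangement.2 H) (h𝒟 H)]
  have hseg := chambers_segment_subset h𝒟 hb hx hwy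
  rintro p hp ⟨H, hH | hH, hpH⟩
  · obtain ⟨α, hα, rfl⟩ := mem_coxeterArrangement_iff.1 hH
    have hpb := hseg hp
    have hp0 : ⟪α, p⟫_ℝ = 0 := hpH
    have hfix : hyperplaneReflection α p = p := by
      rw [hyperplaneReflection_apply hα.1, hp0, mul_zero, zero_smul, sub_zero]
    -- The reflection fixes the point `p` of `b`, hence preserves the chamber `b` and may be used in
    -- the minimality of `w`.
    have hsb : hyperplaneReflection α '' b = b :=
      chambers_eq_of_mem (hs.image_mem_chambers hα.2 hb) hb ⟨p, hpb, hfix⟩ hpb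
    have hle : ‖w y - x‖ ^ 2 ≤ ‖hyperplaneReflection α (w y) - x‖ ^ 2 :=
      hmin (hyperplaneReflection α * w) ⟨W.mul_mem hα.2 hw, by rw [image_mul, hwb, hsb]⟩
    have hX : ⟪α, x⟫_ℝ ≠ 0 := hxr α hα
    have hY : ⟪α, w y⟫_ℝ ≠ 0 := by
      have h1 := hyr _ (map_mem_unitRoots (W.inv_mem hw) hα)
      rw [← w.inner_map_map] at h1
      have h2 : w (w⁻¹ α) = α := w.apply_symm_apply α
      rwa [h2] at h1
    have hexp : ‖hyperplaneReflection α (w y) - x‖ ^ 2 =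
        ‖w y - x‖ ^ 2 + 4 * (⟪α, w y⟫_ℝ * ⟪α, x⟫_ℝ) := by
      rw [hyperplaneReflection_apply hα.1, sub_right_comm, norm_sub_sq_real, norm_smul, hα.1,
        inner_smul_right, real_inner_comm α (w y - x), inner_sub_right, mul_one, Real.norm_eq_abs, sq_abs]
      ring
    -- Minimality and regularity put `x` and `w y` strictly on the same side of the mirror, so the
    -- point `p` between them cannot lie on it.
    have hprod : 0 < ⟪α, w y⟫_ℝ * ⟪α, x⟫_ℝ :=
      lt_of_le_of_ne (by linarith) (mul_ne_zero hY hX).symm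
    obtain ⟨r, s, hr, hs', hrs, rfl⟩ := hp
    rw [inner_add_right, inner_smul_right, inner_smul_right] at hp0
    have hX2 : 0 < ⟪α, x⟫_ℝ ^ 2 := by positivity
    have h0 : r * ⟪α, x⟫_ℝ ^ 2 + s * (⟪α, w y⟫_ℝ * ⟪α, x⟫_ℝ) = 0 := by
      linear_combination ⟪α, x⟫_ℝ * hp0
    have hr0 : r = 0 := by
      by_contra hne
      have : 0 < r := lt_of_le_of_ne hr (Ne.symm hne)
      nlinarith [mul_pos this hX2, mul_nonneg hs' hprod.le]
    subst hr0
    rw [zero_add] at hrs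
    subst hrs
    linarith
  · exact chambers_subset_compl hb (hseg hp) ⟨H, hH, hpH⟩

end Chambers

end CoxeterStable

namespace CoxeterStable

/-! ### Counting chambers and orbits. -/

section Counting

variable {V : Type*} [NormedAddCommGroup V] [InnerProductSpace ℝ V] {W : Subgroup (V ≃ₗᵢ[ℝ] V)}
  {ℬ : Set (Set V)}

theorem image_eq_of_subset {𝒟 : Set (Set V)} (h𝒟 : IsStable W 𝒟) {b b' c : Set V}
    (hb : b ∈ chambers 𝒟) (hb' : b' ∈ chambers 𝒟) (hc : c.Nonempty) (hcb : c ⊆ b)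
    {w : V ≃ₗᵢ[ℝ] V} (hw : w ∈ W) (h : w '' c ⊆ b') : w '' b = b' := by
  obtain ⟨x, hx⟩ := hc
  exact chambers_eq_of_mem (h𝒟.image_mem_chambers hw hb) hb' ⟨x, hcb hx, rfl⟩ (h ⟨x, hx, rfl⟩)

/-- Elements of `W` moving two subsets of one Coxeter chamber to the same set are
equal. -/
theorem eq_of_image_eq_image (hW : IsFiniteReflectionGroup W) {a c c' : Set V}
    (ha : a ∈ chambers (coxeterArrangement W)) (hc : c.Nonempty) (hca : c ⊆ a) (hca' : c' ⊆ a)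
    {w w' : V ≃ₗᵢ[ℝ] V} (hw : w ∈ W) (hw' : w' ∈ W) (h : w '' c = w' '' c') : w = w' := by
  have hmem := W.mul_mem (W.inv_mem hw') hw
  have himage : (w'⁻¹ * w) '' c = c' := by rw [image_mul, h, inv_image_image]
  have h1 := eq_one_of_image_eq hW ha hmem
    (image_eq_of_subset isStable_coxeterArrangement ha ha hc hca hmem (himage.trans_subset hca'))
  exact (inv_mul_eq_one.1 h1).symm

theorem exists_image_eq_of_subset [Finite W] (hℬ : ∀ H ∈ ℬ, IsHyperplane H) (hs : IsStable W ℬ)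
    {b c c' : Set V} (hb : b ∈ chambers ℬ) (hc : c ∈ chambers (coxeterArrangement W ∪ ℬ))
    (hc' : c' ∈ chambers (coxeterArrangement W ∪ ℬ)) (hcb : c ⊆ b) (hcb' : c' ⊆ b) :
    ∃ w ∈ W, w '' b = b ∧ w '' c = c' := by
  have hreg : ∀ d ∈ chambers (coxeterArrangement W ∪ ℬ), ∀ x ∈ d, IsRegular W x :=
    fun d hd x hx => isRegular_of_mem_compl
      (Set.compl_subset_compl.2 (Set.sUnion_subset_sUnion Set.subset_union_left)
        (chambers_subset_compl hd hx))
  obtain ⟨y, hy⟩ := chambers_nonempty hc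
  obtain ⟨x, hx⟩ := chambers_nonempty hc'
  obtain ⟨w, hw, hwb, hmem⟩ := exists_mem_component_of_mem_chamber hℬ hs hb (hcb' hx) (hcb hy)
    (hreg c' hc' x hx) (hreg c hc y hy)
  rw [← chambers_eq_component hc' hx] at hmem
  exact ⟨w, hw, hwb, chambers_eq_of_mem
    ((isStable_coxeterArrangement.union hs).image_mem_chambers hw hc) hc' ⟨y, hy, rfl⟩ hmem⟩

/-- The group acts transitively on the chambers of its Coxeter arrangement. -/
theorem exists_image_eq [Finite W] {a a' : Set V} (ha : a ∈ chambers (coxeterArrangement W))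
    (ha' : a' ∈ chambers (coxeterArrangement W)) : ∃ w ∈ W, w '' a = a' := by
  -- The empty arrangement has the whole space as a chamber, and all of `W` stabilises it.
  have huniv : (Set.univ : Set V) ∈ chambers ∅ :=
    ⟨0, by simp, by simp [connectedComponentIn_univ]⟩
  obtain ⟨w, hw, -, h⟩ := exists_image_eq_of_subset (W := W) (ℬ := ∅) (c := a) (c' := a')
    (by simp) (fun _ _ _ h => h.elim) huniv (by rwa [Set.union_empty]) (by rwa [Set.union_empty])
    (Set.subset_univ _) (Set.subset_univ _)
  exact ⟨w, hw, h⟩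

/-- The isotropy group is simply transitive on these chambers: any of them lies in a Coxeter
chamber, on which `W` acts freely. -/
theorem ncard_chambersIn_eq_card_isotropy (hW : IsFiniteReflectionGroup W) (hℬ : IsArrangement ℬ)
    (hs : IsStable W ℬ) {b : Set V} (hb : b ∈ chambers ℬ) :
    (chambersIn (coxeterArrangement W ∪ ℬ) b).ncard = Nat.card (isotropy W b) := by
  have := hW.1
  obtain ⟨c, hc, hcb⟩ := exists_chamber_subset hℬ (isArrangement_coxeterArrangement.union hℬ)
    (Set.subset_union_right (s := coxeterArrangement W)) hb
  obtain ⟨a, ha, hca⟩ := exists_chamber_superset (Set.subset_union_left (t := ℬ)) hc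
  have hstab := isStable_coxeterArrangement.union hs
  have hbij : Set.BijOn (fun w : V ≃ₗᵢ[ℝ] V => w '' c) (isotropy W b : Set (V ≃ₗᵢ[ℝ] V))
      (chambersIn (coxeterArrangement W ∪ ℬ) b) := by
    refine ⟨?_, ?_, ?_⟩
    · rintro w ⟨hw, hwb⟩
      exact ⟨hstab.image_mem_chambers hw hc, hwb ▸ Set.image_mono hcb⟩
    · rintro w ⟨hw, -⟩ w' ⟨hw', -⟩ h
      exact eq_of_image_eq_image hW ha (chambers_nonempty hc) hca hca hw hw' h
    · rintro c' ⟨hc', hcb'⟩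
      obtain ⟨w, hw, hwb, h⟩ := exists_image_eq_of_subset hℬ.2 hs hb hc hc' hcb hcb'
      exact ⟨w, ⟨hw, hwb⟩, h⟩
  rw [← hbij.image_eq, hbij.injOn.ncard_image]
  rfl

theorem ncard_chambers_coxeterArrangement (hW : IsFiniteReflectionGroup W) {a : Set V}
    (ha : a ∈ chambers (coxeterArrangement W)) :
    (chambers (coxeterArrangement W)).ncard = Nat.card W := by
  have := hW.1
  have hbij : Set.BijOn (fun w : V ≃ₗᵢ[ℝ] V => w '' a) (W : Set (V ≃ₗᵢ[ℝ] V))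
      (chambers (coxeterArrangement W)) := by
    refine ⟨fun w hw => isStable_coxeterArrangement.image_mem_chambers hw ha, ?_, ?_⟩
    · intro w hw w' hw' h
      exact eq_of_image_eq_image hW ha (chambers_nonempty ha) subset_rfl subset_rfl hw hw' h
    · intro a' ha'
      obtain ⟨w, hw, h⟩ := exists_image_eq ha ha'
      exact ⟨w, hw, h⟩
  rw [← hbij.image_eq, hbij.injOn.ncard_image]
  rfl

/-- Every chamber of the union can be moved by `W` into a given Coxeter chamber. -/
theorem exists_image_mem_chambersIn [Finite W] (hs : IsStable W ℬ) {a c : Set V}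
    (ha : a ∈ chambers (coxeterArrangement W)) (hc : c ∈ chambers (coxeterArrangement W ∪ ℬ)) :
    ∃ w ∈ W, w '' c ∈ chambersIn (coxeterArrangement W ∪ ℬ) a := by
  obtain ⟨a', ha', hca'⟩ := exists_chamber_superset (Set.subset_union_left (t := ℬ)) hc
  obtain ⟨w, hw, rfl⟩ := exists_image_eq ha' ha
  exact ⟨w, hw, (isStable_coxeterArrangement.union hs).image_mem_chambers hw hc,
    Set.image_mono hca'⟩

/-- `a` is a fundamental domain: each chamber of the union is `w '' c` for exactly one `w ∈ W` and
one `c` inside `a`. -/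
theorem ncard_chambers_union (hW : IsFiniteReflectionGroup W) (hs : IsStable W ℬ) {a : Set V}
    (ha : a ∈ chambers (coxeterArrangement W)) :
    (chambers (coxeterArrangement W ∪ ℬ)).ncard =
      Nat.card W * (chambersIn (coxeterArrangement W ∪ ℬ) a).ncard := by
  have := hW.1
  have hbij : Set.BijOn (fun p : (V ≃ₗᵢ[ℝ] V) × Set V => p.1 '' p.2)
      ((W : Set (V ≃ₗᵢ[ℝ] V)) ×ˢ chambersIn (coxeterArrangement W ∪ ℬ) a)
      (chambers (coxeterArrangement W ∪ ℬ)) := by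
    refine ⟨?_, ?_, ?_⟩
    · rintro ⟨w, c⟩ ⟨hw, hc, -⟩
      exact (isStable_coxeterArrangement.union hs).image_mem_chambers hw hc
    · rintro ⟨w, c⟩ ⟨hw, hc, hca⟩ ⟨w', c'⟩ ⟨hw', hc', hca'⟩ h
      have h' : w '' c = w' '' c' := h
      obtain rfl := eq_of_image_eq_image hW ha (chambers_nonempty hc) hca hca' hw hw' h'
      rw [Prod.mk.injEq]
      exact ⟨rfl, Set.image_injective.2 w.injective h'⟩
    · intro c hc
      obtain ⟨w, hw, h⟩ := exists_image_mem_chambersIn hs ha hc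
      exact ⟨(w⁻¹, w '' c), ⟨W.inv_mem hw, h⟩, inv_image_image w c⟩
  rw [← hbij.image_eq, hbij.injOn.ncard_image, Set.ncard_prod]
  rfl

theorem orbit_eq_of_image_eq {c c' : Set V} {w : V ≃ₗᵢ[ℝ] V} (hw : w ∈ W) (h : w '' c = c') :
    {d : Set V | ∃ u ∈ W, d = u '' c} = {d | ∃ u ∈ W, d = u '' c'} := by
  subst h
  ext d
  constructor
  · rintro ⟨u, hu, rfl⟩
    exact ⟨u * w⁻¹, W.mul_mem hu (W.inv_mem hw), by rw [image_mul, inv_image_image]⟩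
  · rintro ⟨u, hu, rfl⟩
    exact ⟨u * w, W.mul_mem hu hw, (image_mul u w c).symm⟩

theorem exists_image_eq_of_orbit_eq {c c' : Set V}
    (h : {d : Set V | ∃ u ∈ W, d = u '' c} = {d | ∃ u ∈ W, d = u '' c'}) :
    ∃ u ∈ W, u '' c = c' := by
  have hmem : c' ∈ {d : Set V | ∃ u ∈ W, d = u '' c'} := ⟨1, W.one_mem, (Set.image_id c').symm⟩
  rw [← h] at hmem
  obtain ⟨u, hu, h⟩ := hmem
  exact ⟨u, hu, h.symm⟩

theorem ncard_chambersIn_eq_ncard_orbits_union (hW : IsFiniteReflectionGroup W)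
    (hs : IsStable W ℬ) {a : Set V} (ha : a ∈ chambers (coxeterArrangement W)) :
    (chambersIn (coxeterArrangement W ∪ ℬ) a).ncard =
      (chamberOrbits W (coxeterArrangement W ∪ ℬ)).ncard := by
  have := hW.1
  have hbij : Set.BijOn (fun c : Set V => {d : Set V | ∃ u ∈ W, d = u '' c})
      (chambersIn (coxeterArrangement W ∪ ℬ) a)
      (chamberOrbits W (coxeterArrangement W ∪ ℬ)) := by
    refine ⟨fun c hc => ⟨c, hc.1, rfl⟩, ?_, ?_⟩
    · rintro c ⟨hc, hca⟩ c' ⟨-, hca'⟩ h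
      obtain ⟨u, hu, huc⟩ := exists_image_eq_of_orbit_eq h
      have huid : (1 : V ≃ₗᵢ[ℝ] V) '' c' = c' := Set.image_id c'
      obtain rfl := eq_of_image_eq_image hW ha (chambers_nonempty hc) hca hca' hu W.one_mem
        (huc.trans huid.symm)
      exact (Set.image_id c).symm.trans huc
    · rintro _ ⟨c, hc, rfl⟩
      obtain ⟨w, hw, h⟩ := exists_image_mem_chambersIn hs ha hc
      exact ⟨w '' c, h, (orbit_eq_of_image_eq hw rfl).symm⟩
  rw [← hbij.image_eq, hbij.injOn.ncard_image]

/-- The bijection sends `c` to the orbit of the chamber `β c` of `ℬ` containing it. It is onto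
because every chamber of `ℬ` contains a chamber of the union, which can be moved into `a`. -/
theorem ncard_chambersIn_eq_ncard_orbits (hW : IsFiniteReflectionGroup W) (hℬ : IsArrangement ℬ)
    (hs : IsStable W ℬ) {a : Set V} (ha : a ∈ chambers (coxeterArrangement W)) :
    (chambersIn (coxeterArrangement W ∪ ℬ) a).ncard = (chamberOrbits W ℬ).ncard := by
  have := hW.1
  have hsup : ∀ c ∈ chambers (coxeterArrangement W ∪ ℬ), ∃ b ∈ chambers ℬ, c ⊆ b :=
    fun c hc => exists_chamber_superset Set.subset_union_right hc
  choose! β hβ hcβ using hsup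
  have hstab := isStable_coxeterArrangement.union hs
  have hbij : Set.BijOn (fun c : Set V => {d : Set V | ∃ u ∈ W, d = u '' β c})
      (chambersIn (coxeterArrangement W ∪ ℬ) a) (chamberOrbits W ℬ) := by
    refine ⟨fun c hc => ⟨β c, hβ c hc.1, rfl⟩, ?_, ?_⟩
    · rintro c ⟨hc, hca⟩ c' ⟨hc', hca'⟩ h
      obtain ⟨w, hw, hwb⟩ := exists_image_eq_of_orbit_eq h
      -- `w '' c` and `c'` share the chamber `β c'`, so an isotropy element `u` matches them. Then
      -- `u * w` moves `c` to `c'` inside `a`, and freeness makes it trivial.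
      obtain ⟨u, hu, -, huc⟩ := exists_image_eq_of_subset hℬ.2 hs (hβ c' hc')
        (hstab.image_mem_chambers hw hc) hc' (hwb ▸ Set.image_mono (hcβ c hc)) (hcβ c' hc')
      rw [← image_mul] at huc
      have huid : (1 : V ≃ₗᵢ[ℝ] V) '' c' = c' := Set.image_id c'
      have h1 := eq_of_image_eq_image hW ha (chambers_nonempty hc) hca hca' (W.mul_mem hu hw)
        W.one_mem (huc.trans huid.symm)
      rw [h1] at huc
      exact (Set.image_id c).symm.trans huc
    · rintro _ ⟨b, hb, rfl⟩
      obtain ⟨c, hc, hcb⟩ := exists_chamber_subset hℬ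
        (isArrangement_coxeterArrangement.union hℬ)
        (Set.subset_union_right (s := coxeterArrangement W)) hb
      obtain ⟨w, hw, h⟩ := exists_image_mem_chambersIn hs ha hc
      refine ⟨w '' c, h, (orbit_eq_of_image_eq hw ?_).symm⟩
      exact image_eq_of_subset hs hb (hβ _ h.1) (chambers_nonempty hc) hcb hw (hcβ _ h.1)
  rw [← hbij.image_eq, hbij.injOn.ncard_image]

end Counting

end CoxeterStable

theorem theorem6 {V : Type*} [NormedAddCommGroup V] [InnerProductSpace ℝ V]
    [FiniteDimensional ℝ V] (W : Subgroup (V ≃ₗᵢ[ℝ] V))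
    (hW : CoxeterStable.IsFiniteReflectionGroup W)
    (𝒜 ℬ 𝒞 : Set (Set V))
    (h𝒜 : 𝒜 = CoxeterStable.coxeterArrangement W)
    (hℬ : CoxeterStable.IsArrangement ℬ)
    (hstable : CoxeterStable.IsStable W ℬ)
    (hdisj : 𝒜 ∩ ℬ = ∅)
    (h𝒞 : 𝒞 = 𝒜 ∪ ℬ) :
    ((CoxeterStable.chambers 𝒜).Finite ∧ (CoxeterStable.chambers ℬ).Finite ∧
      (CoxeterStable.chambers 𝒞).Finite) ∧
    (∀ a ∈ CoxeterStable.chambers 𝒜,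
      ((CoxeterStable.chambersIn 𝒞 a).ncard : ℚ) =
        ((CoxeterStable.chambers 𝒞).ncard : ℚ) / ((CoxeterStable.chambers 𝒜).ncard : ℚ) ∧
      ((CoxeterStable.chambersIn 𝒞 a).ncard : ℚ) =
        ((CoxeterStable.chambers 𝒞).ncard : ℚ) / (Nat.card W : ℚ) ∧
      (CoxeterStable.chambersIn 𝒞 a).ncard = (CoxeterStable.chamberOrbits W 𝒞).ncard ∧
      (CoxeterStable.chambersIn 𝒞 a).ncard = (CoxeterStable.chamberOrbits W ℬ).ncard) ∧
    (∀ b ∈ CoxeterStable.chambers ℬ,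
      (CoxeterStable.chambersIn 𝒞 b).ncard = Nat.card (CoxeterStable.isotropy W b)) := by

  have hfin := hW.1
  subst h𝒜 h𝒞
  have h𝒜arr := CoxeterStable.isArrangement_coxeterArrangement (W := W)
  refine ⟨⟨CoxeterStable.finite_chambers h𝒜arr, CoxeterStable.finite_chambers hℬ,
    CoxeterStable.finite_chambers (h𝒜arr.union hℬ)⟩, fun a ha => ?_, fun b hb =>
    CoxeterStable.ncard_chambersIn_eq_card_isotropy hW hℬ hstable hb⟩
  have hcard : (Nat.card W : ℚ) ≠ 0 := Nat.cast_ne_zero.2 Nat.card_pos.ne'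
  have hdiv : ((CoxeterStable.chambersIn (CoxeterStable.coxeterArrangement W ∪ ℬ) a).ncard : ℚ) =
      ((CoxeterStable.chambers (CoxeterStable.coxeterArrangement W ∪ ℬ)).ncard : ℚ) /
        (Nat.card W : ℚ) := by
    rw [CoxeterStable.ncard_chambers_union hW hstable ha, Nat.cast_mul,
      mul_div_cancel_left₀ _ hcard]
  refine ⟨?_, hdiv, CoxeterStable.ncard_chambersIn_eq_ncard_orbits_union hW hstable ha,
    CoxeterStable.ncard_chambersIn_eq_ncard_orbits hW hℬ hstable ha⟩
  rw [CoxeterStable.ncard_chambers_coxeterArrangement hW ha]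
  exact hdiv
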